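/- For $\alpha\in(0,1]$, a set $E\subseteq\mathbb{R}^2$ is called an $F_\alpha$-set if for every direction $e$ in the unit circle there is a unit line segment $\ell_e$ in the direction of $e$ such that $\dim_H(E\cap\ell_e)\ge\alpha$. For a function $h$ which is nonnegative, continuous and non-decreasing on an interval $[0,x_0)$, $x_0>0$, with $h(0)=0$, let $$\mathcal{H}^h(E)=\sup_{\delta>0}\ \inf\Big\{\sum_{i}h(\operatorname{diam}E_i)\ :\ E\subseteq\bigcup_{i=1}^\infty E_i,\ \operatorname{diam}E_i\le\delta\Big\}$$ be the generalized Hausdorff measure with gauge $h$ (it depends only on the values of $h$ near $0$). **Theorem.** Let $\alpha\in(0,1]$ and $\theta>\frac{1+3\alpha}{2}$, and put $h_\theta(x)=x^{\frac{1+3\alpha}{2}}\log^{-\theta}\!\left(\frac1x\right)$ for small $x>0$, $h_\theta(0)=0$. Then there exists an $F_\alpha$-set $E\subseteq\mathbb{R}^2$ with $\mathcal{H}^{h_\theta}(E)=0$. -/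

import Mathlib

open MeasureTheory

namespace Furstenberg

/-- The Euclidean plane. -/
abbrev Plane : Type := EuclideanSpace ℝ (Fin 2)

/-- A set `E` in the plane is an `F_α`-set if for every direction `e` in the unit circle there is a
unit line segment in the direction `e`, from `a` to `a + e`, that meets `E` in a set of Hausdorff
dimension at least `α`. -/
def IsFurstenbergSet (α : ℝ) (E : Set Plane) : Prop :=
  ∀ e : Plane, ‖e‖ = 1 → ∃ a : Plane, ENNReal.ofReal α ≤ dimH (E ∩ segment ℝ a (a + e))

/-- The generalized Hausdorff measure of a gauge function `h`: the supremum over `δ > 0` of the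
infimum of `∑ h (diam Eᵢ)` over countable covers by sets `Eᵢ` of diameter at most `δ`
(see `MeasureTheory.Measure.mkMetric_apply`). Only the values of `h` near `0` matter. -/
noncomputable def gaugeMeasure (h : ℝ → ℝ) : Measure Plane :=
  Measure.mkMetric fun d : ENNReal => ENNReal.ofReal (h d.toReal)

/-- The gauge `x ^ ((1 + 3 α) / 2) * (log (1 / x)) ^ (-θ)`; its value at `x = 0` is `0`. -/
noncomputable def logGauge (α θ : ℝ) (x : ℝ) : ℝ :=
  x ^ ((1 + 3 * α) / 2) * (Real.log (1 / x)) ^ (-θ)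

end Furstenberg

/-! Coincidences between lines make the set small. Write `N = N i`, `m = m i`, `Q = Q i`. A line of
generation `i` has `m ^ 2` children, which differ from it by `(j x / m + k (x / m ^ 2 + 1 / m)) / N`
with `j, k < m`. Where `x / (x / m + 1) = p / q`, this equals `(x / m + 1) (j p + k q) / (q N m)`,
so for `p ≤ q ≤ Q` the children meet that vertical line in `O(m Q)` points rather than `m ^ 2`. Over
the `O(Q ^ 2)` such abscissas, all lines are covered by `O(N m Q ^ 3)` balls of radius `O(1 / (N m ^
2))` (`Scales.exists_center`, `Scales.card_centers_le`). If `Q ≈ m ^ β` with `β < α` and `m` is huge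
compared with `N`, the sum of the powers `(1 + 3 α) / 2` of the diameters is `m ^ (-3 (α - β))`
times a constant depending on `N`, hence small. The power alone gives measure zero, and the
logarithmic factor is at most `1` near `0`.

The abscissas lie in one Cantor set `K`, common to all lines. By Dirichlet's theorem the fractions
with denominator at most `Q` are spread well enough (`exists_spaced_fractions`) for each interval of
length `1 / (2 N)` to have about `(Q / N) ^ 2` separated children. As `m` dominates `N`, this is at
least a power of `N (i + 1)` with exponent just below `β`; with `β` tending to `α`, `K` has
dimension at least `α` (`exists_cantor_set`). Projection to the first axis is Lipschitz, so the part
of each line over `K` is as large. Slopes in `[0, 1]` and the symmetries of the square give all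
directions. -/

namespace Furstenberg

/-! ### Distribution of fractions with bounded denominator -/

lemma card_le_of_forall_sub_le {S : Finset ℕ} {D : ℝ} (hD : 0 ≤ D)
    (h : ∀ a ∈ S, ∀ b ∈ S, (b : ℝ) - a ≤ D) : (S.card : ℝ) ≤ D + 1 := by
  rcases S.eq_empty_or_nonempty with rfl | hS
  · simpa using by linarith
  have h1 := h _ (S.min'_mem hS) _ (S.max'_mem hS)
  have h2 : S ⊆ Finset.Icc (S.min' hS) (S.max' hS) := fun x hx =>
    Finset.mem_Icc.2 ⟨S.min'_le x hx, S.le_max' x hx⟩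
  have h3 := Finset.card_le_card h2
  rw [Nat.card_Icc] at h3
  have h4 : S.card + S.min' hS ≤ S.max' hS + 1 := by
    have := S.min'_le _ (S.max'_mem hS)
    omega
  have h5 : (S.card : ℝ) + S.min' hS ≤ S.max' hS + 1 := by exact_mod_cast h4
  linarith

/-- The interval `[a + c w, a + (c + 1) w]` contains a fraction with denominator at most `Q`. -/
def CellHasFraction (a w : ℝ) (Q c : ℕ) : Prop :=
  ∃ p q : ℕ, 0 < q ∧ q ≤ Q ∧ p ≤ q ∧ a + c * w ≤ (p : ℝ) / q ∧ (p : ℝ) / q ≤ a + (c + 1) * w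

/-- Dirichlet's theorem at the midpoint of the cell gives `p / q` with `q ≤ Q`. If `q * (Q * w) ≥
2`, the error `1 / (q Q)` would be at most `w / 2`, putting `p / q` inside the cell. So a bad cell
is close to a fraction of small denominator. -/
lemma exists_fraction_of_not_cellHasFraction {a w : ℝ} {K Q c : ℕ} (ha : 0 ≤ a) (hw : 0 < w)
    (haw : a + K * w ≤ 1) (hQ : 0 < Q) (hc : c < K) (hbad : ¬ CellHasFraction a w Q c) :
    ∃ p q : ℕ, 0 < q ∧ p ≤ q ∧ (q : ℝ) * (Q * w) < 2 ∧
      |(q : ℝ) * (a + (c + 1 / 2) * w) - p| ≤ 1 / Q := by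
  set x := a + (c + 1 / 2) * w with hx
  have hcK : (c : ℝ) + 1 ≤ K := by exact_mod_cast hc
  have hc0 : (0 : ℝ) ≤ c := c.cast_nonneg
  have hx0 : 0 ≤ x := by positivity
  have hx1 : x ≤ 1 := by nlinarith
  obtain ⟨q, hq, hqQ, h⟩ := Real.exists_nat_abs_mul_sub_round_le x hQ
  have hq' : (0 : ℝ) < q := by exact_mod_cast hq
  have hQ' : (0 : ℝ) < Q := by exact_mod_cast hQ
  have hr0 : 0 ≤ round ((q : ℝ) * x) := by
    rw [round_eq]; exact Int.floor_nonneg.2 (by positivity)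
  have hrq : round ((q : ℝ) * x) ≤ q := by
    rw [round_eq]
    have : (q : ℝ) * x + 1 / 2 < ((q + 1 : ℤ) : ℝ) := by push_cast; nlinarith
    have := Int.floor_lt.2 this
    omega
  obtain ⟨p, hp⟩ := Int.eq_ofNat_of_zero_le hr0
  rw [hp] at h hrq
  have hpq : p ≤ q := by exact_mod_cast hrq
  have h' : |(q : ℝ) * x - p| ≤ 1 / Q := by
    refine le_trans (by simpa using h) ?_
    rw [inv_eq_one_div]
    gcongr
    linarith
  refine ⟨p, q, hq, hpq, ?_, h'⟩
  by_contra! hcon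
  refine hbad ⟨p, q, hq, hqQ, hpq, ?_⟩
  have h2 : 1 / (Q : ℝ) ≤ q * (w / 2) := by
    rw [div_le_iff₀ hQ']; nlinarith
  have h3 := abs_le.1 (h'.trans h2)
  rw [le_div_iff₀ hq', div_le_iff₀ hq']
  constructor <;> nlinarith [h3.1, h3.2]

open Classical in
-- With `v = Q w`, each bad cell is charged to a fraction of denominator `d ≤ 2 / v`. The midpoints
-- charged to one fraction lie within `1 / (d Q)` of it, so there are at most `2 / (d v) + 1 ≤ 4 /
-- (d v)` of them; the `d + 1 ≤ 2 d` numerators give `8 / v` for each `d`.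
lemma card_not_cellHasFraction_le {a w : ℝ} {K Q : ℕ} (ha : 0 ≤ a) (hw : 0 < w)
    (haw : a + K * w ≤ 1) (hQ : 0 < Q) :
    (((Finset.range K).filter fun c => ¬ CellHasFraction a w Q c).card : ℝ) ≤
      16 / (Q * w) ^ 2 := by
  set B := (Finset.range K).filter fun c => ¬ CellHasFraction a w Q c with hB
  have hex : ∀ c, ∃ p q : ℕ, c ∈ B → 0 < q ∧ p ≤ q ∧ (q : ℝ) * (Q * w) < 2 ∧
      |(q : ℝ) * (a + (c + 1 / 2) * w) - p| ≤ 1 / Q := by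
    intro c
    by_cases hc : c ∈ B
    · have := Finset.mem_filter.1 hc
      obtain ⟨p, q, h⟩ := exists_fraction_of_not_cellHasFraction ha hw haw hQ
        (Finset.mem_range.1 this.1) this.2
      exact ⟨p, q, fun _ => h⟩
    · exact ⟨0, 0, fun h => absurd h hc⟩
  choose p q hpq using hex
  have hQ' : (0 : ℝ) < Q := by exact_mod_cast hQ
  set v := (Q : ℝ) * w with hv
  have hv0 : 0 < v := by positivity
  set T := ⌊2 / v⌋₊ with hT
  have hmap : ∀ c ∈ B, q c ∈ Finset.Icc 1 T := by
    intro c hc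
    obtain ⟨h1, -, h3, -⟩ := hpq c hc
    exact Finset.mem_Icc.2 ⟨h1, Nat.le_floor ((le_div_iff₀ hv0).2 h3.le)⟩
  have hfib : ∀ d ∈ Finset.Icc 1 T, ((B.filter fun c => q c = d).card : ℝ) ≤ 8 / v := by
    intro d hd
    have hd1 : 1 ≤ d := (Finset.mem_Icc.1 hd).1
    have hd0 : (1 : ℝ) ≤ d := by exact_mod_cast hd1
    have hdT : (d : ℝ) ≤ 2 / v :=
      (Nat.cast_le.2 (Finset.mem_Icc.1 hd).2).trans (Nat.floor_le (by positivity))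
    have hdv : d * v ≤ 2 := (le_div_iff₀ hv0).1 hdT
    have hmap' : ∀ c ∈ B.filter (fun c => q c = d), p c ∈ Finset.range (d + 1) := by
      intro c hc
      obtain ⟨hcB, rfl⟩ := Finset.mem_filter.1 hc
      exact Finset.mem_range.2 (Nat.lt_succ_of_le (hpq c hcB).2.1)
    rw [Finset.card_eq_sum_card_fiberwise hmap', Nat.cast_sum]
    have hb : ∀ r ∈ Finset.range (d + 1),
        (((B.filter fun c => q c = d).filter fun c => p c = r).card : ℝ) ≤ 4 / (d * v) := by
      intro r _
      have h1 : (1 : ℝ) ≤ 2 / (d * v) := by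
        rw [le_div_iff₀ (by positivity)]; linarith
      have h2 : (4 : ℝ) / (d * v) = 2 / (d * v) + 2 / (d * v) := by ring
      have h3 := card_le_of_forall_sub_le (D := 2 / (d * v))
        (S := (B.filter fun c => q c = d).filter fun c => p c = r) (by positivity) ?_
      · linarith
      intro b hb c hc
      simp only [Finset.mem_filter] at hb hc
      obtain ⟨⟨hbB, hbd⟩, hbr⟩ := hb
      obtain ⟨⟨hcB, hcd⟩, hcr⟩ := hc
      have e1 := abs_le.1 (hpq b hbB).2.2.2
      have e2 := abs_le.1 (hpq c hcB).2.2.2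
      rw [hbd, hbr] at e1
      rw [hcd, hcr] at e2
      rw [le_div_iff₀ (by positivity)]
      have e3 : (d : ℝ) * w * (c - b) ≤ 2 * (1 / Q) := by nlinarith [e1.1, e2.2]
      have e4 : (Q : ℝ) * (1 / Q) = 1 := by field_simp
      calc ((c : ℝ) - b) * (d * v) = Q * (d * w * (c - b)) := by rw [hv]; ring
        _ ≤ Q * (2 * (1 / Q)) := by gcongr
        _ = 2 := by linarith
    refine (Finset.sum_le_sum hb).trans ?_
    rw [Finset.sum_const, Finset.card_range, nsmul_eq_mul]
    have : ((d + 1 : ℕ) : ℝ) ≤ 2 * d := by push_cast; linarith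
    calc ((d + 1 : ℕ) : ℝ) * (4 / (d * v)) ≤ 2 * d * (4 / (d * v)) := by gcongr
      _ = 8 / v := by field_simp; norm_num
  rw [Finset.card_eq_sum_card_fiberwise hmap, Nat.cast_sum]
  refine (Finset.sum_le_sum hfib).trans ?_
  rw [Finset.sum_const, Nat.card_Icc, nsmul_eq_mul]
  calc ((T + 1 - 1 : ℕ) : ℝ) * (8 / v) ≤ 2 / v * (8 / v) := by
        gcongr
        simpa using Nat.floor_le (by positivity)
    _ = 16 / v ^ 2 := by field_simp; norm_num

open Classical in
-- Of `4 M` equal cells at most `2 M` are bad, which is what the factor `128` ensures.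
lemma exists_spaced_fractions {a L : ℝ} {M Q : ℕ} (ha : 0 ≤ a) (hL : 0 < L) (haL : a + L ≤ 1)
    (hM : 0 < M) (hQ : 0 < Q) (hMQ : 128 * (M : ℝ) ≤ L ^ 2 * Q ^ 2) :
    ∃ u : ℕ → ℝ, (∀ k < M, ∃ p q : ℕ, 0 < q ∧ q ≤ Q ∧ p ≤ q ∧ u k = (p : ℝ) / q ∧
      a ≤ u k ∧ u k ≤ a + L) ∧
      ∀ k l, k < l → l < M → ((l : ℝ) - k) * (L / (4 * M)) ≤ u l - u k := by
  have hM' : (0 : ℝ) < M := by exact_mod_cast hM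
  have hQ' : (0 : ℝ) < Q := by exact_mod_cast hQ
  set w := L / (4 * M) with hw
  have hw0 : 0 < w := by positivity
  have hMw : (4 * M : ℝ) * w = L := by rw [hw]; field_simp
  have hKw : a + ((4 * M : ℕ) : ℝ) * w ≤ 1 := by push_cast; linarith
  set S := (Finset.range (4 * M)).filter fun c => CellHasFraction a w Q c with hS
  have hcard : 2 * M ≤ S.card := by
    have h1 := card_not_cellHasFraction_le ha hw0 hKw hQ
    have h2 : 16 / ((Q : ℝ) * w) ^ 2 ≤ 2 * M := by
      rw [div_le_iff₀ (by positivity)]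
      have : 2 * (M : ℝ) * (Q * w) ^ 2 = (4 * M * w) ^ 2 * Q ^ 2 / (8 * M) := by
        field_simp; norm_num
      rw [this, hMw, le_div_iff₀ (by positivity)]
      linarith
    have h3 : S.card + ((Finset.range (4 * M)).filter fun c => ¬ CellHasFraction a w Q c).card =
        4 * M := by
      rw [hS]
      convert Finset.card_filter_add_card_filter_not (s := Finset.range (4 * M))
        (fun c => CellHasFraction a w Q c)
      rw [Finset.card_range]
    have h4 : ((Finset.range (4 * M)).filter fun c => ¬ CellHasFraction a w Q c).card ≤ 2 * M := by
      exact_mod_cast h1.trans h2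
    omega
  have hcell : ∀ k : ℕ, ∃ p q : ℕ, k < S.card → 0 < q ∧ q ≤ Q ∧ p ≤ q ∧
      ∀ h : k < S.card, a + (S.orderEmbOfFin rfl ⟨k, h⟩ : ℕ) * w ≤ (p : ℝ) / q ∧
        (p : ℝ) / q ≤ a + ((S.orderEmbOfFin rfl ⟨k, h⟩ : ℕ) + 1) * w := by
    intro k
    by_cases hk : k < S.card
    · obtain ⟨p, q, h1, h2, h3, h4⟩ :=
        (Finset.mem_filter.1 (S.orderEmbOfFin_mem rfl ⟨k, hk⟩)).2
      exact ⟨p, q, fun _ => ⟨h1, h2, h3, fun _ => h4⟩⟩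
    · exact ⟨0, 0, fun h => absurd h hk⟩
  choose p q hpq using hcell
  -- Only every second good cell is used: the cells numbered `2 k` and `2 l` have at least `2 (l -
  -- k) - 1 ≥ l - k` cell widths between them.
  refine ⟨fun k => (p (2 * k) : ℝ) / q (2 * k), fun k hk => ?_, fun k l hkl hl => ?_⟩
  · have hk2 : 2 * k < S.card := by omega
    obtain ⟨h1, h2, h3, h4⟩ := hpq (2 * k) hk2
    obtain ⟨h5, h6⟩ := h4 hk2
    have hmem := (Finset.mem_filter.1 (S.orderEmbOfFin_mem rfl ⟨2 * k, hk2⟩)).1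
    have hlt : ((S.orderEmbOfFin rfl ⟨2 * k, hk2⟩ : ℕ) : ℝ) + 1 ≤ 4 * M := by
      exact_mod_cast Finset.mem_range.1 hmem
    refine ⟨_, _, h1, h2, h3, rfl, le_trans ?_ h5, h6.trans ?_⟩
    · have : (0 : ℝ) ≤ (S.orderEmbOfFin rfl ⟨2 * k, hk2⟩ : ℕ) * w := by positivity
      linarith
    · nlinarith
  · have hk2 : 2 * k < S.card := by omega
    have hl2 : 2 * l < S.card := by omega
    have h5 := ((hpq (2 * k) hk2).2.2.2 hk2).2
    have h6 := ((hpq (2 * l) hl2).2.2.2 hl2).1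
    have hgap : ∀ n (hn : 2 * k + n < S.card), (S.orderEmbOfFin rfl ⟨2 * k, hk2⟩ : ℕ) + n ≤
        S.orderEmbOfFin rfl ⟨2 * k + n, hn⟩ := by
      intro n
      induction n with
      | zero => intro hn; simp
      | succ n ih =>
        intro hn
        have h7 := ih (by omega)
        have h8 : S.orderEmbOfFin rfl ⟨2 * k + n, by omega⟩ < S.orderEmbOfFin rfl ⟨2 * k + (n + 1), hn⟩ :=
          (S.orderEmbOfFin rfl).strictMono (Fin.mk_lt_mk.2 (by omega))
        omega
    have h7 := hgap (2 * l - 2 * k) (by omega)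
    have h8 : (⟨2 * k + (2 * l - 2 * k), by omega⟩ : Fin S.card) = ⟨2 * l, hl2⟩ :=
      Fin.ext (by simp; omega)
    rw [h8] at h7
    have h9 : ((S.orderEmbOfFin rfl ⟨2 * k, hk2⟩ : ℕ) : ℝ) + 2 * (l - k) ≤
        (S.orderEmbOfFin rfl ⟨2 * l, hl2⟩ : ℕ) := by
      have : (S.orderEmbOfFin rfl ⟨2 * k, hk2⟩ : ℕ) + 2 * l ≤
        (S.orderEmbOfFin rfl ⟨2 * l, hl2⟩ : ℕ) + 2 * k := by omega
      have : ((S.orderEmbOfFin rfl ⟨2 * k, hk2⟩ : ℕ) : ℝ) + 2 * l ≤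
        (S.orderEmbOfFin rfl ⟨2 * l, hl2⟩ : ℕ) + 2 * k := by exact_mod_cast this
      linarith
    have h10 : (k : ℝ) + 1 ≤ l := by exact_mod_cast hkl
    have h11 : ((S.orderEmbOfFin rfl ⟨2 * k, hk2⟩ : ℕ) + 1 + ((l : ℝ) - k)) * w ≤
        (S.orderEmbOfFin rfl ⟨2 * l, hl2⟩ : ℕ) * w := by
      gcongr; linarith
    show ((l : ℝ) - k) * w ≤ (p (2 * l) : ℝ) / q (2 * l) - (p (2 * k) : ℝ) / q (2 * k)
    linarith

/-- The abscissas at which the lines `y = j x / m + k (x / m ^ 2 + 1 / m)` meet often are plentiful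
and well spaced. -/
lemma exists_spaced_meeting_points {a L : ℝ} {m M Q : ℕ} (ha : 0 ≤ a) (hL : 0 < L)
    (haL : a + L ≤ 1 / 2) (hm : 2 ≤ m) (hM : 0 < M) (hQ : 0 < Q)
    (hMQ : 8192 * (M : ℝ) ≤ L ^ 2 * Q ^ 2) :
    ∃ x : ℕ → ℝ, (∀ k < M, (∃ p q : ℕ, 0 < q ∧ q ≤ Q ∧ p ≤ q ∧ x k = p * m / (q * m - p)) ∧
      a ≤ x k ∧ x k ≤ a + L / 2) ∧
      ∀ k l, k < l → l < M → ((l : ℝ) - k) * (L / (32 * M)) ≤ x l - x k := by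
  have hm' : (2 : ℝ) ≤ m := by exact_mod_cast hm
  have hM' : (0 : ℝ) < M := by exact_mod_cast hM
  -- The meeting abscissas are the images of fractions under `u ↦ u / (1 - u / m)`, whose inverse is
  -- `x ↦ x / (1 + x / m)`. On `[0, 1]` it expands distances by a factor between `1` and `4`, so a
  -- window of length `L / 8` lands in one of length `L / 2`; the other half of `[a, a + L]` leaves
  -- room for a child interval.
  set a' := a / (1 + a / m) with ha'
  have hden : 1 ≤ 1 + a / m := by
    have : 0 ≤ a / (m : ℝ) := by positivity
    linarith
  have ha'0 : 0 ≤ a' := by positivity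
  have ha'a : a' ≤ a := div_le_self ha hden
  have hφa : a' / (1 - a' / m) = a := by
    have h1 : 1 - a' / m = 1 / (1 + a / m) := by rw [ha']; field_simp; ring
    rw [h1, ha']; field_simp
  obtain ⟨u, hu, hsp⟩ := exists_spaced_fractions (a := a') (L := L / 8) (M := M) (Q := Q) ha'0
    (by positivity) (by linarith) hM hQ (by nlinarith)
  have hlow : ∀ v : ℝ, 0 ≤ v → v ≤ 1 → 1 / 2 ≤ 1 - v / m ∧ 1 - v / m ≤ 1 := by
    intro v h0 h1
    have h2 : v / m ≤ 1 / 2 := by rw [div_le_iff₀ (by linarith)]; linarith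
    have h3 : 0 ≤ v / m := by positivity
    constructor <;> linarith
  have hdiff : ∀ v v' : ℝ, 0 ≤ v → v ≤ v' → v' ≤ 1 →
      v' - v ≤ v' / (1 - v' / m) - v / (1 - v / m) ∧
      v' / (1 - v' / m) - v / (1 - v / m) ≤ 4 * (v' - v) := by
    intro v v' h0 h1 h2
    obtain ⟨h3, h4⟩ := hlow v h0 (h1.trans h2)
    obtain ⟨h5, h6⟩ := hlow v' (h0.trans h1) h2
    have h7 : v' / (1 - v' / m) - v / (1 - v / m) = (v' - v) / ((1 - v' / m) * (1 - v / m)) := by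
      have : (1 - v' / m) ≠ 0 := by linarith
      have : (1 - v / m) ≠ 0 := by linarith
      rw [div_sub_div _ _ (by assumption) (by assumption)]
      congr 1
      field_simp
      ring
    have h8 : 0 < (1 - v' / m) * (1 - v / m) := by nlinarith
    have h9 : (1 - v' / m) * (1 - v / m) ≤ 1 := by nlinarith
    have h10 : 1 / 4 ≤ (1 - v' / m) * (1 - v / m) := by nlinarith
    rw [h7, le_div_iff₀ h8, div_le_iff₀ h8]
    constructor <;> nlinarith
  have hua : ∀ k < M, 0 ≤ u k ∧ u k ≤ 1 := fun k hk => by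
    obtain ⟨p, q, -, -, -, -, h1, h2⟩ := hu k hk
    constructor <;> linarith
  refine ⟨fun k => u k / (1 - u k / m), fun k hk => ?_, fun k l hkl hl => ?_⟩
  · obtain ⟨p, q, h1, h2, h3, h4, h5, h6⟩ := hu k hk
    have hq : (0 : ℝ) < q := by exact_mod_cast h1
    have hpq : (p : ℝ) ≤ q := by exact_mod_cast h3
    obtain ⟨h7, h8⟩ := hdiff a' (u k) ha'0 h5 (hua k hk).2
    rw [hφa] at h7 h8
    refine ⟨⟨p, q, h1, h2, h3, ?_⟩, by simp only; linarith, by simp only; linarith⟩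
    have h9 : (q : ℝ) * m - p ≠ 0 := by nlinarith
    have h10 : 1 - u k / m ≠ 0 := by have := (hlow _ (hua k hk).1 (hua k hk).2).1; linarith
    rw [div_eq_div_iff h10 h9, h4]
    field_simp
  · have h1 := hsp k l hkl hl
    have h2 : (k : ℝ) < l := by exact_mod_cast hkl
    have h3 : 0 ≤ ((l : ℝ) - k) * (L / 8 / (4 * M)) := by
      have : 0 ≤ (l : ℝ) - k := by linarith
      positivity
    have h4 := (hdiff (u k) (u l) (hua k (hkl.trans hl)).1 (by linarith) (hua l hl).2).1
    have h5 : L / (32 * M) = L / 8 / (4 * M) := by field_simp; norm_num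
    rw [h5]
    exact h1.trans h4

/-! ### Cantor sets and their Hausdorff dimension -/

lemma exists_mem_nested_Icc {a r : ℕ → ℝ} (ha : ∀ i, a i ≤ a (i + 1))
    (hr : ∀ i, a (i + 1) + r (i + 1) ≤ a i + r i) (hr0 : ∀ i, 0 ≤ r i) :
    ∃ x, ∀ i, a i ≤ x ∧ x ≤ a i + r i := by
  refine ⟨⨆ i, a i, fun i => ?_⟩
  have h1 := monotone_nat_of_le_succ ha
  have h2 := antitone_nat_of_succ_le (f := fun i => a i + r i) hr
  have := ciSup_mem_iInter_Icc_of_antitone_Icc (f := a) (g := fun i => a i + r i)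
    (fun m n hmn => Set.Icc_subset_Icc (h1 hmn) (h2 hmn)) (fun i => by linarith [hr0 i])
  simpa using Set.mem_iInter.1 this i

/-- A set containing an inverse-Hölder image of `[0, 1)` has large Hausdorff dimension. -/
lemma le_dimH_of_inverse_holder {K : Set ℝ} {g : ℝ → ℝ} {C r : ℝ} (hr : 0 < r) (hC : 0 ≤ C)
    (hg : ∀ y ∈ Set.Ico (0 : ℝ) 1, g y ∈ K)
    (h : ∀ y ∈ Set.Ico (0 : ℝ) 1, ∀ z ∈ Set.Ico (0 : ℝ) 1, y < z →
      z - y ≤ C * |g z - g y| ^ r) : ENNReal.ofReal r ≤ dimH K := by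
  have habs : ∀ y ∈ Set.Ico (0 : ℝ) 1, ∀ z ∈ Set.Ico (0 : ℝ) 1,
      |y - z| ≤ C * |g y - g z| ^ r := by
    intro y hy z hz
    rcases lt_trichotomy y z with hyz | rfl | hyz
    · rw [abs_sub_comm, abs_of_pos (by linarith), abs_sub_comm]
      exact h y hy z hz hyz
    · simp only [sub_self, abs_zero]; positivity
    · rw [abs_of_pos (by linarith)]
      exact h z hz y hy hyz
  set f := Function.invFunOn g (Set.Ico (0 : ℝ) 1) with hf
  have hinj : Set.InjOn g (Set.Ico (0 : ℝ) 1) := by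
    intro y hy z hz hyz
    have h1 := habs y hy z hz
    rw [hyz, sub_self, abs_zero, Real.zero_rpow hr.ne', mul_zero] at h1
    linarith [abs_nonpos_iff.1 h1]
  have hfg : ∀ y ∈ Set.Ico (0 : ℝ) 1, f (g y) = y := fun y hy => hinj.leftInvOn_invFunOn hy
  have hhol : HolderOnWith C.toNNReal r.toNNReal f (g '' Set.Ico (0 : ℝ) 1) := by
    rintro _ ⟨y, hy, rfl⟩ _ ⟨z, hz, rfl⟩
    rw [hfg y hy, hfg z hz, edist_dist, edist_dist, Real.coe_toNNReal r hr.le,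
      ENNReal.ofReal_rpow_of_nonneg dist_nonneg hr.le, ← ENNReal.ofReal_coe_nnreal,
      Real.coe_toNNReal C hC, ← ENNReal.ofReal_mul hC]
    exact ENNReal.ofReal_le_ofReal (habs y hy z hz)
  have h1 := hhol.dimH_image_le (Real.toNNReal_pos.2 hr)
  have h2 : f '' (g '' Set.Ico (0 : ℝ) 1) = Set.Ico (0 : ℝ) 1 := by
    rw [← Set.image_comp]
    ext y
    constructor
    · rintro ⟨z, hz, rfl⟩
      simpa [hfg z hz] using hz
    · intro hy
      exact ⟨y, hy, hfg y hy⟩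
  have h3 : dimH (Set.Ico (0 : ℝ) 1) = 1 := by
    rw [Real.dimH_of_nonempty_interior (by simp)]
    simp
  rw [h2, h3] at h1
  have h4 : dimH (g '' Set.Ico (0 : ℝ) 1) ≤ dimH K := dimH_mono (by
    rintro _ ⟨y, hy, rfl⟩; exact hg y hy)
  have h5 : (r.toNNReal : ENNReal) ≠ 0 := by simpa using hr
  rw [ENNReal.le_div_iff_mul_le (Or.inl h5) (Or.inl ENNReal.coe_ne_top), one_mul] at h1
  exact h1.trans h4

/-- The position of the interval reached by following the mixed-radix digits of `A`. -/
noncomputable def cantorPos (M : ℕ → ℕ) (child : ℕ → ℝ → ℕ → ℝ) : ℕ → ℕ → ℝ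
  | 0, _ => 0
  | i + 1, A => child i (cantorPos M child i (A / M i)) (A % M i)

/-- The number of intervals of generation `i`. -/
def cantorCount (M : ℕ → ℕ) (i : ℕ) : ℕ := ∏ j ∈ Finset.range i, M j

lemma cantorCount_succ (M : ℕ → ℕ) (i : ℕ) : cantorCount M (i + 1) = cantorCount M i * M i :=
  Finset.prod_range_succ _ _

lemma two_pow_le_cantorCount {M : ℕ → ℕ} (hM : ∀ i, 2 ≤ M i) (i : ℕ) :
    2 ^ i ≤ cantorCount M i := by
  induction i with
  | zero => simp [cantorCount]
  | succ i ih => rw [cantorCount_succ, pow_succ]; exact Nat.mul_le_mul ih (hM i)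

lemma floor_mul_mul_div (y : ℝ) (P M : ℕ) (hM : 0 < M) :
    ⌊y * ((P * M : ℕ) : ℝ)⌋₊ / M = ⌊y * P⌋₊ := by
  have hM' : (M : ℝ) ≠ 0 := by exact_mod_cast hM.ne'
  rw [← Nat.floor_div_natCast]
  congr 1
  push_cast
  field_simp

section Cantor

variable {L s : ℕ → ℝ} {M : ℕ → ℕ} {child : ℕ → ℝ → ℕ → ℝ}

lemma cantorPos_mem {l : ℝ} (hM : ∀ i, 2 ≤ M i) (hl : L 0 ≤ l)
    (hchild : ∀ i a, 0 ≤ a → a + L i ≤ l → ∀ k < M i,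
      a ≤ child i a k ∧ child i a k + L (i + 1) ≤ a + L i) (i A : ℕ) :
    0 ≤ cantorPos M child i A ∧ cantorPos M child i A + L i ≤ l := by
  induction i generalizing A with
  | zero => simpa [cantorPos] using hl
  | succ i ih =>
    obtain ⟨h1, h2⟩ := ih (A / M i)
    obtain ⟨h3, h4⟩ := hchild i _ h1 h2 (A % M i) (Nat.mod_lt _ (by have := hM i; omega))
    simp only [cantorPos]
    constructor <;> linarith

lemma exists_cantor_point {l : ℝ} (hM : ∀ i, 2 ≤ M i) (hL : ∀ i, 0 ≤ L i) (hl : L 0 ≤ l)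
    (hchild : ∀ i a, 0 ≤ a → a + L i ≤ l → ∀ k < M i,
      a ≤ child i a k ∧ child i a k + L (i + 1) ≤ a + L i) (y : ℝ) :
    ∃ x, ∀ i, cantorPos M child i ⌊y * cantorCount M i⌋₊ ≤ x ∧
      x ≤ cantorPos M child i ⌊y * cantorCount M i⌋₊ + L i := by
  have key : ∀ i, cantorPos M child i ⌊y * cantorCount M i⌋₊ ≤
        cantorPos M child (i + 1) ⌊y * cantorCount M (i + 1)⌋₊ ∧
      cantorPos M child (i + 1) ⌊y * cantorCount M (i + 1)⌋₊ + L (i + 1) ≤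
        cantorPos M child i ⌊y * cantorCount M i⌋₊ + L i := by
    intro i
    have hM0 : 0 < M i := by have := hM i; omega
    obtain ⟨h1, h2⟩ := cantorPos_mem (L := L) hM hl hchild i ⌊y * cantorCount M i⌋₊
    have h3 := hchild i _ h1 h2 (⌊y * cantorCount M (i + 1)⌋₊ % M i) (Nat.mod_lt _ hM0)
    have h4 : cantorPos M child (i + 1) ⌊y * cantorCount M (i + 1)⌋₊ =
        child i (cantorPos M child i ⌊y * cantorCount M i⌋₊)
          (⌊y * cantorCount M (i + 1)⌋₊ % M i) := by
      rw [cantorPos, cantorCount_succ, floor_mul_mul_div _ _ _ hM0]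
    rw [h4]
    exact h3
  exact exists_mem_nested_Icc (fun i => (key i).1) (fun i => (key i).2) hL

/-- Let `i + 1` be the first generation at which `y` and `z` have different codes, differing by `D`.
The codes are siblings, so the images are at least `D * s i` apart, while `z - y` is at most `2 D`
divided by the number of intervals of generation `i + 1`. -/
lemma cantor_inverse_holder {l r C : ℝ} (hM : ∀ i, 2 ≤ M i) (hl : L 0 ≤ l)
    (hchild : ∀ i a, 0 ≤ a → a + L i ≤ l → ∀ k < M i,
      a ≤ child i a k ∧ child i a k + L (i + 1) ≤ a + L i)
    (hs : ∀ i, 0 ≤ s i) (hr : 0 < r) (hr1 : r ≤ 1) (hC : 0 ≤ C)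
    (hsep : ∀ i a, 0 ≤ a → a + L i ≤ l → ∀ k k', k < k' → k' < M i →
      ((k' : ℝ) - k) * s i + L (i + 1) ≤ child i a k' - child i a k)
    (hCP : ∀ i, 2 ≤ C * cantorCount M i * (M i * s i) ^ r)
    {g : ℝ → ℝ} (hg : ∀ (y : ℝ) i, cantorPos M child i ⌊y * cantorCount M i⌋₊ ≤ g y ∧
      g y ≤ cantorPos M child i ⌊y * cantorCount M i⌋₊ + L i)
    {y z : ℝ} (hy : 0 ≤ y) (hz : z < 1) (hyz : y < z) :
    z - y ≤ C * |g z - g y| ^ r := by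
  have hex : ∃ i, ⌊y * cantorCount M i⌋₊ ≠ ⌊z * cantorCount M i⌋₊ := by
    obtain ⟨i, hi⟩ := exists_nat_gt (1 / (z - y))
    have h1 : (i : ℝ) ≤ cantorCount M i := by
      exact_mod_cast (Nat.lt_two_pow_self (n := i)).le.trans (two_pow_le_cantorCount hM i)
    refine ⟨i, fun h => ?_⟩
    have h2 : 1 < (z - y) * cantorCount M i := by
      rw [div_lt_iff₀ (by linarith)] at hi
      nlinarith
    have h3 := Nat.floor_le (a := y * cantorCount M i) (by positivity)
    have h4 := Nat.lt_floor_add_one (z * cantorCount M i)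
    rw [← h] at h4
    nlinarith
  classical
  have hne := Nat.find_spec hex
  have hmin := fun j => Nat.find_min (m := j) hex
  obtain ⟨i, hi⟩ : ∃ i, Nat.find hex = i + 1 := by
    refine Nat.exists_eq_succ_of_ne_zero fun h0 => ?_
    rw [h0] at hne
    refine hne ?_
    have h1 : ⌊y * cantorCount M 0⌋₊ = 0 := Nat.floor_eq_zero.2 (by simp [cantorCount]; linarith)
    have h2 : ⌊z * cantorCount M 0⌋₊ = 0 := Nat.floor_eq_zero.2 (by simp [cantorCount]; linarith)
    rw [h1, h2]
  rw [hi] at hne hmin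
  have heq : ⌊y * cantorCount M i⌋₊ = ⌊z * cantorCount M i⌋₊ := not_not.1 (hmin i (by omega))
  have hM0 : 0 < M i := by have := hM i; omega
  have hP0 : (0 : ℝ) < cantorCount M i := by
    exact_mod_cast (Nat.pow_pos two_pos).trans_le (two_pow_le_cantorCount hM i)
  have hM0' : (0 : ℝ) < M i := by exact_mod_cast hM0
  set A := ⌊y * cantorCount M (i + 1)⌋₊ with hA
  set B := ⌊z * cantorCount M (i + 1)⌋₊ with hB
  have hAB : A < B := lt_of_le_of_ne (Nat.floor_mono (by gcongr)) hne
  have hAd : A / M i = ⌊y * cantorCount M i⌋₊ := by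
    rw [hA, cantorCount_succ, floor_mul_mul_div _ _ _ hM0]
  have hBd : B / M i = ⌊y * cantorCount M i⌋₊ := by
    rw [hB, cantorCount_succ, floor_mul_mul_div _ _ _ hM0, heq]
  have hA' := Nat.div_add_mod A (M i)
  have hB' := Nat.div_add_mod B (M i)
  rw [hAd] at hA'
  rw [hBd] at hB'
  have hlt : A % M i < B % M i := by omega
  have hBM := Nat.mod_lt B hM0
  have hdiff : (B : ℝ) - A = ((B % M i : ℕ) : ℝ) - (A % M i : ℕ) := by
    have : B + A % M i = A + B % M i := by omega
    have : (B : ℝ) + (A % M i : ℕ) = A + (B % M i : ℕ) := by exact_mod_cast this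
    linarith
  obtain ⟨h1, h2⟩ := cantorPos_mem (L := L) hM hl hchild i ⌊y * cantorCount M i⌋₊
  have h3 := hsep i _ h1 h2 _ _ hlt hBM
  have h4 := (hg y (i + 1)).2
  have h5 := (hg z (i + 1)).1
  rw [← hA, cantorPos, hAd] at h4
  rw [← hB, cantorPos, hBd] at h5
  rw [← hdiff] at h3
  set D := (B : ℝ) - A with hD
  have hD1 : 1 ≤ D := by
    have : (A : ℝ) + 1 ≤ B := by exact_mod_cast hAB
    linarith
  have hDM : D ≤ M i := by
    rw [hdiff]
    have : ((B % M i : ℕ) : ℝ) ≤ M i := by exact_mod_cast hBM.le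
    have : (0 : ℝ) ≤ (A % M i : ℕ) := Nat.cast_nonneg _
    linarith
  have hgz : D * s i ≤ |g z - g y| := le_trans (by linarith) (le_abs_self _)
  have hzy : (z - y) * (cantorCount M i * M i) ≤ 2 * D := by
    have e1 := Nat.lt_floor_add_one (z * cantorCount M (i + 1))
    have e2 := Nat.floor_le (a := y * cantorCount M (i + 1)) (by positivity)
    rw [← hB] at e1
    rw [← hA] at e2
    have e3 : (cantorCount M (i + 1) : ℝ) = cantorCount M i * M i := by
      rw [cantorCount_succ]; push_cast; ring
    rw [e3] at e1 e2
    nlinarith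
  -- Siblings satisfy `D ≤ M i`; this reduces every `D` to the extreme case `D = M i`, which is
  -- `hCP`.
  have hrat : D / M i ≤ (D / M i) ^ r := by
    have e1 : D / M i ≤ 1 := (div_le_one hM0').2 hDM
    calc D / M i = (D / M i) ^ (1 : ℝ) := (Real.rpow_one _).symm
      _ ≤ (D / M i) ^ r := Real.rpow_le_rpow_of_exponent_ge (by positivity) e1 hr1
  have hDs : (D * s i) ^ r = (D / M i) ^ r * (M i * s i) ^ r := by
    rw [← Real.mul_rpow (by positivity) (mul_nonneg hM0'.le (hs i))]
    congr 1
    field_simp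
  calc z - y ≤ 2 * D / (cantorCount M i * M i) := (le_div_iff₀ (by positivity)).2 hzy
    _ = 2 * (D / M i) / cantorCount M i := by field_simp
    _ ≤ (C * cantorCount M i * (M i * s i) ^ r) * (D / M i) ^ r / cantorCount M i := by
        refine div_le_div_of_nonneg_right (mul_le_mul (hCP i) hrat ?_ ?_) hP0.le
        · exact div_nonneg (by linarith) hM0'.le
        · linarith [hCP i]
    _ = C * (D * s i) ^ r := by rw [hDs]; field_simp
    _ ≤ C * |g z - g y| ^ r := by
        have := hs i
        gcongr

end Cantor

/-- A Cantor-type set whose generation `i` consists of intervals of length `L i`, each of which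
contains `M i` well separated intervals of the next generation with left ends in `X i`. -/
theorem exists_cantor_set {L s : ℕ → ℝ} {M : ℕ → ℕ} {l : ℝ} {X : ℕ → Set ℝ} {α : ℝ} (hα : α ≤ 1)
    (hM : ∀ i, 2 ≤ M i) (hL : ∀ i, 0 ≤ L i) (hl : L 0 ≤ l) (hs : ∀ i, 0 < s i)
    (hchild : ∀ i a, 0 ≤ a → a + L i ≤ l → ∃ x : ℕ → ℝ,
      (∀ k < M i, x k ∈ X i ∧ a ≤ x k ∧ x k + L (i + 1) ≤ a + L i) ∧
      ∀ k k', k < k' → k' < M i → ((k' : ℝ) - k) * s i + L (i + 1) ≤ x k' - x k)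
    (hdim : ∀ r, 0 < r → r < α → ∀ᶠ i in Filter.atTop, 1 ≤ cantorCount M i * (M i * s i) ^ r) :
    ∃ K : Set ℝ, (∀ x ∈ K, 0 ≤ x ∧ x ≤ l ∧ ∀ i, ∃ x₀ ∈ X i, x₀ ≤ x ∧ x ≤ x₀ + L (i + 1)) ∧
      ENNReal.ofReal α ≤ dimH K := by
  have hex : ∀ i a, ∃ x : ℕ → ℝ, 0 ≤ a → a + L i ≤ l →
      (∀ k < M i, x k ∈ X i ∧ a ≤ x k ∧ x k + L (i + 1) ≤ a + L i) ∧
      ∀ k k', k < k' → k' < M i → ((k' : ℝ) - k) * s i + L (i + 1) ≤ x k' - x k := by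
    intro i a
    by_cases h : 0 ≤ a ∧ a + L i ≤ l
    · obtain ⟨x, hx⟩ := hchild i a h.1 h.2
      exact ⟨x, fun _ _ => hx⟩
    · exact ⟨0, fun h1 h2 => absurd ⟨h1, h2⟩ h⟩
  choose child hch using hex
  have hch1 : ∀ i a, 0 ≤ a → a + L i ≤ l → ∀ k < M i,
      a ≤ child i a k ∧ child i a k + L (i + 1) ≤ a + L i :=
    fun i a h1 h2 k hk => ((hch i a h1 h2).1 k hk).2
  choose g hg using exists_cantor_point hM hL hl hch1
  refine ⟨g '' Set.Ico 0 1, ?_, ?_⟩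
  · rintro _ ⟨y, -, rfl⟩
    refine ⟨?_, ?_, fun i => ?_⟩
    · have := hg y 0
      simp only [cantorPos] at this
      exact this.1
    · have := hg y 0
      simp only [cantorPos] at this
      linarith [this.2]
    · have h1 := hg y (i + 1)
      have hM0 : 0 < M i := by have := hM i; omega
      rw [cantorPos] at h1
      obtain ⟨h2, h3⟩ := cantorPos_mem (L := L) hM hl hch1 i
        (⌊y * cantorCount M (i + 1)⌋₊ / M i)
      exact ⟨_, ((hch i _ h2 h3).1 _ (Nat.mod_lt _ hM0)).1, h1⟩
  · refine le_of_forall_lt fun c hc => ?_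
    obtain ⟨r, hcr, hrα⟩ := ENNReal.lt_iff_exists_real_btwn.1 hc |>.imp fun r hr => hr.2
    have hr0 : 0 < r := ENNReal.ofReal_pos.1 (lt_of_le_of_lt bot_le hcr)
    have hrα' : r < α := (ENNReal.ofReal_lt_ofReal_iff_of_nonneg hr0.le).1 hrα
    refine hcr.trans_le ?_
    obtain ⟨n, hn⟩ := Filter.eventually_atTop.1 (hdim r hr0 hrα')
    have hpos : ∀ i, 0 < cantorCount M i * (M i * s i) ^ r := by
      intro i
      have h1 : (0 : ℝ) < cantorCount M i := by
        exact_mod_cast (Nat.pow_pos two_pos).trans_le (two_pow_le_cantorCount hM i)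
      have h2 : (0 : ℝ) < M i := by have := hM i; exact_mod_cast (by omega : 0 < M i)
      have := hs i
      positivity
    -- The sum absorbs the finitely many generations not covered by `hdim`.
    obtain ⟨C, hC⟩ : ∃ C : ℝ, 0 ≤ C ∧ ∀ i, 2 ≤ C * (cantorCount M i * (M i * s i) ^ r) := by
      have h1 : ∀ j ∈ Finset.range n, 0 ≤ 2 / (cantorCount M j * (M j * s j) ^ r) :=
        fun j _ => div_nonneg zero_le_two (hpos j).le
      refine ⟨2 + ∑ j ∈ Finset.range n, 2 / (cantorCount M j * (M j * s j) ^ r),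
        add_nonneg zero_le_two (Finset.sum_nonneg h1), fun i => ?_⟩
      by_cases hi : i < n
      · have h2 := Finset.single_le_sum h1 (Finset.mem_range.2 hi)
        rw [← div_le_iff₀ (hpos i)]
        linarith
      · have h2 := hn i (by omega)
        have h3 := Finset.sum_nonneg h1
        nlinarith
    refine le_dimH_of_inverse_holder (g := g) hr0 hC.1 (fun y hy => ⟨y, hy, rfl⟩) ?_
    intro y hy z hz hyz
    exact cantor_inverse_holder hM hl hch1 (fun i => (hs i).le) hr0 (by linarith) hC.1
      (fun i a h1 h2 => (hch i a h1 h2).2) (fun i => by rw [mul_assoc]; exact hC.2 i) hg hy.1 hz.2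
      hyz

/-! ### Choice of the scales -/

lemma eventually_le_natCast_rpow {c : ℝ} (hc : 0 < c) (B : ℝ) :
    ∀ᶠ m : ℕ in Filter.atTop, B ≤ (m : ℝ) ^ c :=
  ((tendsto_rpow_atTop hc).comp tendsto_natCast_atTop_atTop).eventually_ge_atTop B

/-- Take `Q ≈ m ^ β` with `β` halfway between `β'` and `α`, and `m` large. The gap `β - β'` absorbs
the constants depending on `N` in the bound for `M`, and the gap `α - β` those in the covering sum.
-/
lemma exists_scale {N : ℕ} (hN : 1 ≤ N) {α β' ε : ℝ} (hβ' : 0 ≤ β') (hβα : β' < α) (hα : α ≤ 1)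
    (hε : 0 < ε) :
    ∃ m Q M : ℕ, 2 ≤ m ∧ 2 ≤ M ∧ 0 < Q ∧ Q ≤ m ∧ 32768 * N ^ 2 * M ≤ Q ^ 2 ∧
      (128 * (N * (m : ℝ) ^ 2)) ^ β' ≤ M ∧
      24 * N * m * (Q : ℝ) ^ 3 * (10 / (N * (m : ℝ) ^ 2)) ^ ((1 + 3 * α) / 2) ≤ ε := by
  set β := (β' + α) / 2 with hβ
  have hN' : (1 : ℝ) ≤ N := by exact_mod_cast hN
  set A : ℝ := 24 * N * (10 / N) ^ ((1 + 3 * α) / 2) with hA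
  -- The four demands on `m` yield, in order, `Q ≥ 1`, `M ≥ 2`, the lower bound for `M`, and the
  -- small covering sum.
  have e1 := eventually_le_natCast_rpow (c := β) (by linarith) 1
  have e2 := eventually_le_natCast_rpow (c := 2 * β) (by linarith) (4 * 32768 * N ^ 2 * 2)
  have e3 := eventually_le_natCast_rpow (c := 2 * (β - β')) (by linarith)
    (8 * 32768 * N ^ 2 * (128 * N) ^ β')
  have e4 := eventually_le_natCast_rpow (c := 3 * (α - β)) (by linarith) (A / ε)
  obtain ⟨m, h1, h2, h3, h4, hm⟩ :=
    (e1.and (e2.and (e3.and (e4.and (Filter.eventually_ge_atTop 2))))).exists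
  have hm2 : (2 : ℝ) ≤ m := by exact_mod_cast hm
  have hm0 : (0 : ℝ) < m := by linarith
  set Q := ⌊(m : ℝ) ^ β⌋₊ with hQ
  set M := Q ^ 2 / (32768 * N ^ 2) with hM
  have hQ0 : 1 ≤ Q := Nat.le_floor (by simpa using h1)
  have hQ1 : (1 : ℝ) ≤ Q := by exact_mod_cast hQ0
  have hQle : (Q : ℝ) ≤ (m : ℝ) ^ β := Nat.floor_le (by positivity)
  have hQge : (m : ℝ) ^ β ≤ 2 * Q := by
    have := Nat.lt_floor_add_one ((m : ℝ) ^ β)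
    rw [← hQ] at this
    linarith
  have hsq : (m : ℝ) ^ (2 * β) ≤ 4 * (Q : ℝ) ^ 2 := by
    have : (m : ℝ) ^ (2 * β) = ((m : ℝ) ^ β) ^ 2 := by
      rw [← Real.rpow_natCast, ← Real.rpow_mul hm0.le]; congr 1; push_cast; ring
    rw [this]
    have : (0 : ℝ) ≤ (m : ℝ) ^ β := by positivity
    nlinarith
  have hD : 0 < 32768 * N ^ 2 := by positivity
  have hM2 : 2 ≤ M := by
    rw [hM, Nat.le_div_iff_mul_le hD]
    have : (2 : ℝ) * (32768 * N ^ 2) ≤ (Q : ℝ) ^ 2 := by linarith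
    exact_mod_cast this
  have hMge : (Q : ℝ) ^ 2 ≤ 2 * (32768 * N ^ 2) * M := by
    have e5 : Q ^ 2 < 32768 * N ^ 2 * (M + 1) := Nat.lt_mul_div_succ _ hD
    have e6 : (Q : ℝ) ^ 2 < 32768 * N ^ 2 * (M + 1) := by exact_mod_cast e5
    have e7 : (2 : ℝ) ≤ M := by exact_mod_cast hM2
    have e8 : (0 : ℝ) < 32768 * N ^ 2 := by positivity
    nlinarith
  refine ⟨m, Q, M, hm, hM2, hQ0, ?_, Nat.mul_div_le _ _, ?_, ?_⟩
  · have : (Q : ℝ) ≤ m := hQle.trans (by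
      calc (m : ℝ) ^ β ≤ (m : ℝ) ^ (1 : ℝ) :=
            Real.rpow_le_rpow_of_exponent_le (by linarith) (by linarith)
        _ = m := Real.rpow_one _)
    exact_mod_cast this
  · have e5 : (128 * (N * (m : ℝ) ^ 2)) ^ β' = (128 * N) ^ β' * (m : ℝ) ^ (2 * β') := by
      rw [show 128 * (N * (m : ℝ) ^ 2) = (128 * N) * (m : ℝ) ^ 2 by ring,
        Real.mul_rpow (by positivity) (by positivity), ← Real.rpow_natCast (m : ℝ) 2,
        ← Real.rpow_mul hm0.le]
      norm_num
    have e6 : (m : ℝ) ^ (2 * (β - β')) * (m : ℝ) ^ (2 * β') = (m : ℝ) ^ (2 * β) := by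
      rw [← Real.rpow_add hm0]; congr 1; ring
    have e7 : (0 : ℝ) < (m : ℝ) ^ (2 * β') := by positivity
    have e8 : (8 * 32768 * N ^ 2 : ℝ) * ((128 * N) ^ β' * (m : ℝ) ^ (2 * β')) ≤
        (8 * 32768 * N ^ 2 : ℝ) * M := by
      calc (8 * 32768 * N ^ 2 : ℝ) * ((128 * N) ^ β' * (m : ℝ) ^ (2 * β'))
          = (8 * 32768 * N ^ 2 * (128 * N) ^ β') * (m : ℝ) ^ (2 * β') := by ring
        _ ≤ (m : ℝ) ^ (2 * (β - β')) * (m : ℝ) ^ (2 * β') := by gcongr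
        _ ≤ 4 * (Q : ℝ) ^ 2 := by rw [e6]; exact hsq
        _ ≤ _ := by linarith
    rw [e5]
    exact le_of_mul_le_mul_left e8 (by positivity)
  · have e5 : (10 / (N * (m : ℝ) ^ 2)) ^ ((1 + 3 * α) / 2) =
        (10 / N) ^ ((1 + 3 * α) / 2) * (m : ℝ) ^ (-(1 + 3 * α)) := by
      rw [show 10 / (N * (m : ℝ) ^ 2) = (10 / N) * (m : ℝ) ^ (-2 : ℝ) by
          rw [Real.rpow_neg hm0.le]; norm_num; field_simp,
        Real.mul_rpow (by positivity) (by positivity), ← Real.rpow_mul hm0.le]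
      congr 2; ring
    have e6 : (m : ℝ) * ((m : ℝ) ^ β) ^ 3 * (m : ℝ) ^ (-(1 + 3 * α)) =
        ((m : ℝ) ^ (3 * (α - β)))⁻¹ := by
      rw [← Real.rpow_natCast ((m : ℝ) ^ β), ← Real.rpow_mul hm0.le, ← Real.rpow_neg hm0.le]
      nth_rewrite 1 [← Real.rpow_one (m : ℝ)]
      rw [← Real.rpow_add hm0, ← Real.rpow_add hm0]
      congr 1; push_cast; ring
    have hA0 : 0 ≤ A := by positivity
    have e7 : (0 : ℝ) < (m : ℝ) ^ (3 * (α - β)) := by positivity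
    calc 24 * N * m * (Q : ℝ) ^ 3 * (10 / (N * (m : ℝ) ^ 2)) ^ ((1 + 3 * α) / 2)
        ≤ 24 * N * m * ((m : ℝ) ^ β) ^ 3 *
          ((10 / N) ^ ((1 + 3 * α) / 2) * (m : ℝ) ^ (-(1 + 3 * α))) := by
          rw [e5]; gcongr
      _ = A * ((m : ℝ) * ((m : ℝ) ^ β) ^ 3 * (m : ℝ) ^ (-(1 + 3 * α))) := by rw [hA]; ring
      _ = A / (m : ℝ) ^ (3 * (α - β)) := by rw [e6]; rfl
      _ ≤ ε := by
          rw [div_le_iff₀ hε] at h4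
          rw [div_le_iff₀ e7]
          linarith

/-- The parameters of the construction: `N i` is the resolution of generation `i`. -/
structure Scales (α : ℝ) (N m Q M : ℕ → ℕ) : Prop where
  zero : N 0 = 1
  succ : ∀ i, N (i + 1) = N i * m i ^ 2
  two_le_m : ∀ i, 2 ≤ m i
  two_le_M : ∀ i, 2 ≤ M i
  Q_pos : ∀ i, 0 < Q i
  Q_le : ∀ i, Q i ≤ m i
  M_le : ∀ i, 32768 * N i ^ 2 * M i ≤ Q i ^ 2
  le_M : ∀ i : ℕ, (128 * (N (i + 1) : ℝ)) ^ (α * (i / (i + 1))) ≤ M i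
  cover : ∀ i : ℕ, 24 * N i * m i * (Q i : ℝ) ^ 3 *
    (10 / (N (i + 1) : ℝ)) ^ ((1 + 3 * α) / 2) ≤ 1 / (i + 1)

lemma exists_scales {α : ℝ} (hα0 : 0 < α) (hα1 : α ≤ 1) :
    ∃ N m Q M : ℕ → ℕ, Scales α N m Q M := by
  have hstep : ∀ i N : ℕ, ∃ m Q M : ℕ, 1 ≤ N → 2 ≤ m ∧ 2 ≤ M ∧ 0 < Q ∧ Q ≤ m ∧
      32768 * N ^ 2 * M ≤ Q ^ 2 ∧ (128 * (N * (m : ℝ) ^ 2)) ^ (α * ((i : ℝ) / (i + 1))) ≤ M ∧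
      24 * N * m * (Q : ℝ) ^ 3 * (10 / (N * (m : ℝ) ^ 2)) ^ ((1 + 3 * α) / 2) ≤
        1 / ((i : ℝ) + 1) := by
    intro i N
    by_cases hN : 1 ≤ N
    · have h1 : (i : ℝ) / (i + 1) < 1 := by rw [div_lt_one (by positivity)]; linarith
      -- The exponent `α * (i / (i + 1))` stays below `α` and tends to it, while the covering bound
      -- tends to `0`.
      obtain ⟨m, Q, M, h⟩ := exists_scale hN (α := α) (β' := α * ((i : ℝ) / (i + 1)))
        (ε := 1 / ((i : ℝ) + 1)) (by positivity) (by nlinarith) hα1 (by positivity)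
      exact ⟨m, Q, M, fun _ => h⟩
    · exact ⟨0, 0, 0, fun h => absurd h hN⟩
  choose m Q M h using hstep
  obtain ⟨N, hN0, hs⟩ : ∃ N : ℕ → ℕ, N 0 = 1 ∧ ∀ i, N (i + 1) = N i * m i (N i) ^ 2 :=
    ⟨fun i => Nat.rec 1 (fun i N => N * m i N ^ 2) i, rfl, fun _ => rfl⟩
  have hN : ∀ i, 1 ≤ N i := by
    intro i
    induction i with
    | zero => exact hN0.ge
    | succ i ih =>
      rw [hs]
      have := (h i (N i) ih).1
      exact Nat.mul_pos ih (by positivity)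
  have hs' : ∀ i : ℕ, (N (i + 1) : ℝ) = (N i : ℝ) * (m i (N i) : ℝ) ^ 2 := by
    intro i
    exact_mod_cast hs i
  refine ⟨N, fun i => m i (N i), fun i => Q i (N i), fun i => M i (N i), ⟨hN0, hs, ?_, ?_, ?_, ?_, ?_,
    ?_, ?_⟩⟩
  · exact fun i => (h i (N i) (hN i)).1
  · exact fun i => (h i (N i) (hN i)).2.1
  · exact fun i => (h i (N i) (hN i)).2.2.1
  · exact fun i => (h i (N i) (hN i)).2.2.2.1
  · exact fun i => (h i (N i) (hN i)).2.2.2.2.1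
  · intro i
    rw [hs']
    exact (h i (N i) (hN i)).2.2.2.2.2.1
  · intro i
    rw [hs']
    exact (h i (N i) (hN i)).2.2.2.2.2.2

namespace Scales

variable {α : ℝ} {N m Q M : ℕ → ℕ}

lemma four_pow_le (h : Scales α N m Q M) (i : ℕ) : 4 ^ i ≤ N i := by
  induction i with
  | zero => simp [h.zero]
  | succ i ih =>
    rw [h.succ, pow_succ]
    exact Nat.mul_le_mul ih (by have := h.two_le_m i; nlinarith)

lemma N_pos (h : Scales α N m Q M) (i : ℕ) : 0 < N i :=
  (Nat.pow_pos (by norm_num)).trans_le (h.four_pow_le i)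

lemma tendsto_N (h : Scales α N m Q M) :
    Filter.Tendsto (fun i => (N i : ℝ)) Filter.atTop Filter.atTop := by
  refine tendsto_natCast_atTop_atTop.comp (Filter.tendsto_atTop_mono (fun i => ?_) Filter.tendsto_id)
  exact (Nat.lt_pow_self (by norm_num)).le.trans (h.four_pow_le i)

end Scales

/-! ### The lines, their meeting points and the covering balls -/

/-- The intercept of the `A`-th line of generation `i`, whose slope is `A / N i`. -/
noncomputable def lineOffset (N m : ℕ → ℕ) : ℕ → ℕ → ℝ
  | 0, _ => 0
  | i + 1, A => lineOffset N m i (A / m i ^ 2) + ((A % m i ^ 2 % m i : ℕ) : ℝ) / (N i * m i)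

/-- The abscissas of the meeting points of the lines of one generation. -/
def meetingPoints (m Q : ℕ) : Set ℝ :=
  {x | ∃ p q : ℕ, 0 < q ∧ q ≤ Q ∧ p ≤ q ∧ x = p * m / (q * m - p)}

namespace Scales

variable {α : ℝ} {N m Q M : ℕ → ℕ}

/-- Passing to a child raises the offset by at most `1 / N i`, and `2 / N (i + 1) ≤ 1 / N i`, so the
intervals are nested and every slope `t` has a limit line. -/
lemma exists_intercept (h : Scales α N m Q M) (t : ℝ) :
    ∃ b, ∀ i, lineOffset N m i ⌊t * N i⌋₊ ≤ b ∧ b ≤ lineOffset N m i ⌊t * N i⌋₊ + 2 / N i := by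
  have hN : ∀ i, (0 : ℝ) < N i := fun i => by exact_mod_cast h.N_pos i
  have key : ∀ i, ∃ d : ℝ, 0 ≤ d ∧ d ≤ 1 / N i ∧
      lineOffset N m (i + 1) ⌊t * N (i + 1)⌋₊ = lineOffset N m i ⌊t * N i⌋₊ + d := by
    intro i
    have hm0 : 0 < m i := by have := h.two_le_m i; omega
    have hm : (0 : ℝ) < m i := by exact_mod_cast hm0
    refine ⟨((⌊t * N (i + 1)⌋₊ % m i ^ 2 % m i : ℕ) : ℝ) / (N i * m i), by positivity, ?_, ?_⟩
    · have h1 : ((⌊t * N (i + 1)⌋₊ % m i ^ 2 % m i : ℕ) : ℝ) ≤ m i := by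
        exact_mod_cast (Nat.mod_lt _ hm0).le
      rw [div_le_div_iff₀ (mul_pos (hN i) hm) (hN i)]
      nlinarith [hN i]
    · rw [lineOffset, h.succ, floor_mul_mul_div _ _ _ (by positivity)]
  refine exists_mem_nested_Icc (fun i => ?_) (fun i => ?_) fun i => (div_pos two_pos (hN i)).le
  · obtain ⟨d, h1, -, h3⟩ := key i
    linarith
  · obtain ⟨d, -, h2, h3⟩ := key i
    have h4 : (2 : ℝ) / N (i + 1) ≤ 1 / N i := by
      have : (2 : ℝ) * N i ≤ N (i + 1) := by
        have h5 := h.succ i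
        have h6 := h.two_le_m i
        have h7 : 2 * N i ≤ N (i + 1) := by
          rw [h5]
          nlinarith [Nat.mul_le_mul_left (N i) (show 2 ≤ m i ^ 2 by nlinarith)]
        exact_mod_cast h7
      rw [div_le_div_iff₀ (hN _) (hN _)]
      linarith
    have h5 : (2 : ℝ) / N i = 1 / N i + 1 / N i := by ring
    linarith

/-- The point of the plane coded by the line `A` of generation `i`, the fraction `p / q` and the
level `l`. -/
noncomputable def center (N m : ℕ → ℕ) (i A p q l : ℕ) : Plane :=
  !₂[(p * m i / (q * m i - p) : ℝ),
    lineOffset N m i A + A / N i * (p * m i / (q * m i - p) : ℝ) +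
      ((p * m i / (q * m i - p) : ℝ) / m i + 1) * l / (q * N i * m i)]

/-- The limit line stays within `O(1 / N (i + 1))` of its approximating line of generation `i + 1`,
which at `x₀` passes exactly through a center, at level `l = j p + k q`. -/
lemma exists_center (h : Scales α N m Q M) {t b : ℝ} (ht0 : 0 ≤ t) (ht1 : t ≤ 1)
    (hb : ∀ i, lineOffset N m i ⌊t * N i⌋₊ ≤ b ∧ b ≤ lineOffset N m i ⌊t * N i⌋₊ + 2 / N i)
    (i : ℕ) {v : Plane} (hx1 : v 0 ≤ 1 / 2) (hv : v 1 = b + t * v 0) {x₀ : ℝ}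
    (hx₀ : x₀ ∈ meetingPoints (m i) (Q i)) (hle : x₀ ≤ v 0) (hge : v 0 ≤ x₀ + 1 / (2 * N (i + 1))) :
    ∃ A p q l : ℕ, A ≤ N i ∧ p ≤ Q i ∧ q ≤ Q i ∧ l ≤ 2 * m i * Q i ∧
      v ∈ Metric.closedBall (center N m i A p q l) (5 / N (i + 1)) := by
  obtain ⟨p, q, hq0, hqQ, hpq, rfl⟩ := hx₀
  have hN : (0 : ℝ) < N i := by exact_mod_cast h.N_pos i
  have hN1 : (0 : ℝ) < N (i + 1) := by exact_mod_cast h.N_pos (i + 1)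
  have hm0 : 0 < m i := by have := h.two_le_m i; omega
  have hm2 : (2 : ℝ) ≤ m i := by exact_mod_cast h.two_le_m i
  have hm : (0 : ℝ) < m i := by linarith
  have hq : (0 : ℝ) < q := by exact_mod_cast hq0
  have hpq' : (p : ℝ) ≤ q := by exact_mod_cast hpq
  have hNs : (N (i + 1) : ℝ) = N i * (m i : ℝ) ^ 2 := by exact_mod_cast h.succ i
  set A' := ⌊t * N (i + 1)⌋₊ with hA'
  set A := ⌊t * N i⌋₊ with hA
  set j := A' % m i ^ 2 / m i with hj
  set k := A' % m i ^ 2 % m i with hk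
  have hAA : A' / m i ^ 2 = A := by
    rw [hA', h.succ, floor_mul_mul_div _ _ _ (by positivity)]
  have hjm : j < m i := Nat.div_lt_of_lt_mul (by rw [← pow_two]; exact Nat.mod_lt _ (by positivity))
  have hkm : k < m i := Nat.mod_lt _ hm0
  have hA'eq : (A' : ℝ) = m i ^ 2 * A + (m i * j + k) := by
    have h1 := Nat.div_add_mod A' (m i ^ 2)
    have h2 := Nat.div_add_mod (A' % m i ^ 2) (m i)
    rw [hAA, ← h2] at h1
    exact_mod_cast h1.symm
  have hden : 0 < (q : ℝ) * m i - p := by nlinarith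
  obtain ⟨hb1, hb2⟩ := hb (i + 1)
  rw [← hA', lineOffset, hAA, ← hk] at hb1 hb2
  set x₀ : ℝ := p * m i / (q * m i - p) with hx₀
  have hx₀0 : 0 ≤ x₀ := by positivity
  have hx₀q : (q : ℝ) * x₀ = p * (x₀ / m i + 1) := by
    rw [hx₀]; field_simp; ring
  have ht2 : (A' : ℝ) / N (i + 1) ≤ t := by
    rw [div_le_iff₀ hN1]; exact Nat.floor_le (by positivity)
  have ht3 : t ≤ (A' : ℝ) / N (i + 1) + 1 / N (i + 1) := by
    rw [← add_div, le_div_iff₀ hN1]; exact (Nat.lt_floor_add_one _).le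
  have hslope : (A' : ℝ) / N (i + 1) = A / N i + (m i * j + k) / (N i * (m i : ℝ) ^ 2) := by
    rw [hA'eq, hNs]; field_simp
  have hmeet : lineOffset N m i A + (k : ℝ) / (N i * m i) + A' / N (i + 1) * x₀ =
      lineOffset N m i A + A / N i * x₀ +
        (x₀ / m i + 1) * ((j * p + k * q : ℕ) : ℝ) / (q * N i * m i) := by
    have e1 : (x₀ / m i + 1) * ((j * p + k * q : ℕ) : ℝ) =
        j * (q * x₀) + k * q * (x₀ / m i + 1) := by
      rw [hx₀q]; push_cast; ring
    rw [hslope, e1]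
    field_simp
    ring
  refine ⟨A, p, q, j * p + k * q, ?_, hpq.trans hqQ, hqQ, ?_, ?_⟩
  · have h1 : (A : ℝ) ≤ N i := (Nat.floor_le (by positivity)).trans (by nlinarith)
    exact_mod_cast h1
  · have h1 : j * p ≤ m i * Q i := Nat.mul_le_mul hjm.le (hpq.trans hqQ)
    have h2 : k * q ≤ m i * Q i := Nat.mul_le_mul hkm.le hqQ
    nlinarith
  · have e0 : (1 : ℝ) / (2 * N (i + 1)) = 1 / N (i + 1) / 2 := by field_simp
    have e2 : (2 : ℝ) / N (i + 1) = 2 * (1 / N (i + 1)) := by ring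
    have e5 : (5 : ℝ) / N (i + 1) = 5 * (1 / N (i + 1)) := by ring
    rw [e0] at hge
    rw [e2] at hb2
    rw [e5]
    set η : ℝ := 1 / N (i + 1) with hη
    have hη0 : 0 < η := by positivity
    have d0 : |v 0 - x₀| ≤ η := abs_le.2 ⟨by linarith, by linarith⟩
    have d1 : |v 1 - (lineOffset N m i A + A / N i * x₀ +
        (x₀ / m i + 1) * ((j * p + k * q : ℕ) : ℝ) / (q * N i * m i))| ≤ 4 * η := by
      rw [← hmeet, hv]
      set τ : ℝ := A' / N (i + 1)
      set c : ℝ := lineOffset N m i A + (k : ℝ) / (N i * m i)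
      -- The three terms are the errors in intercept, slope and abscissa: at most `2 η`, `η` and `η
      -- / 2`.
      have e6 : b + t * v 0 - (c + τ * x₀) = (b - c) + (t - τ) * x₀ + t * (v 0 - x₀) := by ring
      rw [e6, abs_le]
      constructor
      · have e7 : 0 ≤ (t - τ) * x₀ := mul_nonneg (by linarith) hx₀0
        have e8 : 0 ≤ t * (v 0 - x₀) := mul_nonneg ht0 (by linarith)
        linarith
      · have e7 : (t - τ) * x₀ ≤ η * 1 :=
          mul_le_mul (by linarith) (by linarith) hx₀0 hη0.le
        have e8 : t * (v 0 - x₀) ≤ 1 * (η / 2) :=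
          mul_le_mul ht1 (by linarith) (by linarith) zero_le_one
        linarith
    rw [Metric.mem_closedBall, EuclideanSpace.dist_eq, Fin.sum_univ_two, Real.sqrt_le_left (by positivity)]
    simp only [Real.dist_eq, center, Matrix.cons_val_zero, Matrix.cons_val_one, PiLp.toLp_apply]
    rw [← hx₀]
    refine (add_le_add (pow_le_pow_left₀ (abs_nonneg _) d0 2)
      (pow_le_pow_left₀ (abs_nonneg _) d1 2)).trans ?_
    rw [show (5 * η) ^ 2 = η ^ 2 + (4 * η) ^ 2 + 8 * η ^ 2 by ring]
    exact le_add_of_nonneg_right (by positivity)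

open Classical in
/-- The centers of the balls covering the set at generation `i + 1`. -/
noncomputable def centers (N m Q : ℕ → ℕ) (i : ℕ) : Finset Plane :=
  (Finset.range (N i + 1) ×ˢ Finset.range (Q i + 1) ×ˢ Finset.range (Q i + 1) ×ˢ
    Finset.range (2 * m i * Q i + 1)).image fun z => center N m i z.1 z.2.1 z.2.2.1 z.2.2.2

lemma card_centers_le (h : Scales α N m Q M) (i : ℕ) :
    (centers N m Q i).card ≤ 24 * N i * m i * Q i ^ 3 := by
  refine Finset.card_image_le.trans ?_
  simp only [Finset.card_product, Finset.card_range]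
  have h1 := h.N_pos i
  have h2 := h.Q_pos i
  have h3 := h.two_le_m i
  calc (N i + 1) * ((Q i + 1) * ((Q i + 1) * (2 * m i * Q i + 1)))
      ≤ (2 * N i) * ((2 * Q i) * ((2 * Q i) * (3 * m i * Q i))) := by
        gcongr
        · omega
        · omega
        · omega
        · nlinarith
    _ = 24 * N i * m i * Q i ^ 3 := by ring

/-- The common set of abscissas of the chosen points on all lines. -/
lemma exists_abscissas (h : Scales α N m Q M) (hα1 : α ≤ 1) :
    ∃ K : Set ℝ, (∀ x ∈ K, 0 ≤ x ∧ x ≤ 1 / 2 ∧ ∀ i, ∃ x₀ ∈ meetingPoints (m i) (Q i),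
      x₀ ≤ x ∧ x ≤ x₀ + 1 / (2 * N (i + 1))) ∧ ENNReal.ofReal α ≤ dimH K := by
  have hN : ∀ i, (0 : ℝ) < N i := fun i => by exact_mod_cast h.N_pos i
  have hM : ∀ i, (0 : ℝ) < M i := fun i => by
    have := h.two_le_M i
    exact_mod_cast (by omega : 0 < M i)
  -- The meeting points are spaced by `2 * s i`: one `s i` is kept as the gap, the other pays for
  -- the length of a child. Since `M i * s i = 1 / (128 N i)`, the dimension condition reads `(128 N
  -- i) ^ r ≤ cantorCount M i`.
  refine exists_cantor_set (L := fun i => 1 / (2 * (N i : ℝ))) (l := 1 / 2)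
    (s := fun i => 1 / (128 * N i * M i)) hα1 h.two_le_M (fun i => (by have := hN i; positivity))
    (by simp [h.zero]) (fun i => (by have := hN i; have := hM i; positivity)) ?_ ?_
  · intro i a ha hal
    have hNi := hN i
    have hMi := hM i
    have hm2 : (2 : ℝ) ≤ m i := by exact_mod_cast h.two_le_m i
    have hNs : (N (i + 1) : ℝ) = N i * (m i : ℝ) ^ 2 := by exact_mod_cast h.succ i
    have hMQ : 32768 * (N i : ℝ) ^ 2 * M i ≤ (Q i : ℝ) ^ 2 := by exact_mod_cast h.M_le i
    have hQm : (Q i : ℝ) ≤ m i := by exact_mod_cast h.Q_le i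
    have hN1 : (1 : ℝ) ≤ N i := by exact_mod_cast h.N_pos i
    have hMm : 128 * (M i : ℝ) ≤ (m i : ℝ) ^ 2 := by
      have h1 : (Q i : ℝ) ^ 2 ≤ (m i : ℝ) ^ 2 := by gcongr
      nlinarith [mul_le_mul_of_nonneg_right (one_le_pow₀ hN1 (n := 2)) hMi.le]
    have hL1 : 1 / (2 * (N (i + 1) : ℝ)) ≤ 1 / (2 * N i) / 2 := by
      rw [hNs, div_div, div_le_div_iff₀ (by positivity) (by positivity)]
      nlinarith [mul_le_mul_of_nonneg_left (show (4 : ℝ) ≤ (m i : ℝ) ^ 2 by nlinarith) hNi.le]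
    obtain ⟨x, hx, hsep⟩ := exists_spaced_meeting_points (L := 1 / (2 * N i)) (M := M i)
      (Q := Q i) ha (by positivity) hal (h.two_le_m i)
      (by have := h.two_le_M i; omega) (h.Q_pos i) (by
        have e : (1 / (2 * (N i : ℝ))) ^ 2 * (Q i : ℝ) ^ 2 = Q i ^ 2 / (4 * N i ^ 2) := by
          field_simp; ring
        rw [e, le_div_iff₀ (by positivity)]
        linarith)
    refine ⟨x, fun k hk => ?_, fun k k' hkk hk' => ?_⟩
    · obtain ⟨h1, h2, h3⟩ := hx k hk
      exact ⟨h1, h2, by linarith⟩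
    · have h1 := hsep k k' hkk hk'
      have h2 : (k : ℝ) + 1 ≤ k' := by exact_mod_cast hkk
      have e1 : 1 / (2 * (N i : ℝ)) / (32 * M i) = 2 * (1 / (128 * N i * M i)) := by
        field_simp; norm_num
      have e2 : 1 / (2 * (N (i + 1) : ℝ)) ≤ 1 / (128 * N i * M i) := by
        rw [hNs, div_le_div_iff₀ (by positivity) (by positivity)]
        nlinarith
      have e3 : 0 < 1 / (128 * (N i : ℝ) * M i) := by positivity
      rw [e1] at h1
      nlinarith
  · intro r hr hrα
    have hlim : Filter.Tendsto (fun i : ℕ => α * ((i : ℝ) / (i + 1))) Filter.atTop (nhds α) := by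
      simpa using (tendsto_natCast_div_add_atTop (𝕜 := ℝ) 1).const_mul α
    -- Shifts the index: the bound at generation `i + 1` comes from the last factor `M i` of the
    -- count alone.
    have hev := (Filter.tendsto_add_atTop_iff_nat (f := fun i => 1 ≤ (cantorCount M i : ℝ) *
      (M i * (1 / (128 * N i * M i))) ^ r) (l := Filter.principal {p | p}) 1)
    simp only [Filter.tendsto_principal, Set.mem_ofPred_eq] at hev
    refine hev.1 ?_
    filter_upwards [hlim.eventually_const_lt hrα] with i hi
    have h1 : (M (i + 1) : ℝ) * (1 / (128 * N (i + 1) * M (i + 1))) =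
        (128 * (N (i + 1) : ℝ))⁻¹ := by
      have := hM (i + 1)
      field_simp
    have hN1 : (1 : ℝ) ≤ N (i + 1) := by exact_mod_cast h.N_pos (i + 1)
    have h2 : (128 * (N (i + 1) : ℝ)) ^ r ≤ M i :=
      (Real.rpow_le_rpow_of_exponent_le (by linarith) hi.le).trans (h.le_M i)
    have h3 : (M i : ℝ) ≤ cantorCount M (i + 1) := by
      rw [cantorCount_succ]
      exact_mod_cast Nat.le_mul_of_pos_left _
        ((Nat.pow_pos two_pos).trans_le (two_pow_le_cantorCount h.two_le_M i))
    have h4 : (0 : ℝ) < (128 * (N (i + 1) : ℝ)) ^ r := by positivity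
    rw [h1, Real.inv_rpow (by positivity), ← div_eq_mul_inv, le_div_iff₀ h4, one_mul]
    exact h2.trans h3

end Scales

/-! ### From coverings to gauge measure zero -/

lemma logGauge_le_rpow {α θ d R : ℝ} (hα : 0 < α) (hθ : 0 ≤ θ) (hd : 0 ≤ d) (hdR : d ≤ R)
    (hR : R ≤ Real.exp (-1)) : logGauge α θ d ≤ R ^ ((1 + 3 * α) / 2) := by
  have hR0 : 0 ≤ R := hd.trans hdR
  rcases hd.eq_or_lt with rfl | hd0
  · rw [logGauge, Real.zero_rpow (by positivity), zero_mul]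
    positivity
  · have h1 : 1 ≤ Real.log (1 / d) := by
      rw [one_div, Real.log_inv, le_neg, Real.log_le_iff_le_exp hd0]
      exact hdR.trans hR
    calc logGauge α θ d ≤ d ^ ((1 + 3 * α) / 2) * 1 := by
          rw [logGauge]
          gcongr
          exact Real.rpow_le_one_of_one_le_of_nonpos h1 (by linarith)
      _ ≤ R ^ ((1 + 3 * α) / 2) := by rw [mul_one]; gcongr

lemma gaugeMeasure_logGauge_eq_zero {α θ : ℝ} (hα : 0 < α) (hθ : 0 ≤ θ) {E : Set Plane}
    {F : ℕ → Finset Plane} {ρ ε : ℕ → ℝ} (hρ : Filter.Tendsto ρ Filter.atTop (nhds 0))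
    (hε : Filter.Tendsto ε Filter.atTop (nhds 0))
    (hE : ∀ i, ∀ v ∈ E, ∃ c ∈ F i, v ∈ Metric.closedBall c (ρ i))
    (hF : ∀ i, (F i).card * (2 * ρ i) ^ ((1 + 3 * α) / 2) ≤ ε i) :
    gaugeMeasure (logGauge α θ) E = 0 := by
  have hρ2 : Filter.Tendsto (fun i => 2 * ρ i) Filter.atTop (nhds 0) := by
    simpa using hρ.const_mul 2
  have hofReal {f : ℕ → ℝ} (hf : Filter.Tendsto f Filter.atTop (nhds 0)) :
      Filter.Tendsto (fun i => ENNReal.ofReal (f i)) Filter.atTop (nhds 0) := by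
    simpa using ENNReal.tendsto_ofReal hf
  have hdiam : ∀ i (c : F i), Metric.ediam (Metric.closedBall (c : Plane) (ρ i)) ≤
      ENNReal.ofReal (2 * ρ i) := by
    intro i c
    refine Metric.ediam_le fun u hu v hv => ?_
    rw [edist_dist]
    refine ENNReal.ofReal_le_ofReal ((dist_triangle_right u v c).trans ?_)
    linarith [Metric.mem_closedBall.1 hu, Metric.mem_closedBall.1 hv]
  have h1 := Measure.mkMetric_le_liminf_sum (ι := fun i => F i) E
    (fun i => ENNReal.ofReal (2 * ρ i)) (hofReal hρ2)
    (fun i c => Metric.closedBall (c : Plane) (ρ i)) (Filter.Eventually.of_forall hdiam)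
    (Filter.Eventually.of_forall fun i v hv => by
      obtain ⟨c, hc, hvc⟩ := hE i v hv
      exact Set.mem_iUnion.2 ⟨⟨c, hc⟩, hvc⟩)
    (fun d => ENNReal.ofReal (logGauge α θ d.toReal))
  refine le_antisymm (h1.trans ?_) bot_le
  rw [← (hofReal hε).liminf_eq]
  refine Filter.liminf_le_liminf ?_
  filter_upwards [hρ2.eventually_le_const (Real.exp_pos (-1))] with i hi
  by_cases hρi : 0 ≤ ρ i
  · calc ∑ c : F i, ENNReal.ofReal (logGauge α θ
            (Metric.ediam (Metric.closedBall (c : Plane) (ρ i))).toReal)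
        ≤ ∑ _c : F i, ENNReal.ofReal ((2 * ρ i) ^ ((1 + 3 * α) / 2)) := by
          refine Finset.sum_le_sum fun c _ => ENNReal.ofReal_le_ofReal
            (logGauge_le_rpow hα hθ ENNReal.toReal_nonneg ?_ hi)
          exact ENNReal.toReal_le_of_le_ofReal (by positivity) (hdiam i c)
      _ = ENNReal.ofReal ((F i).card * (2 * ρ i) ^ ((1 + 3 * α) / 2)) := by
          rw [Finset.sum_const, Finset.card_univ, Fintype.card_coe, nsmul_eq_mul,
            ENNReal.ofReal_mul (Nat.cast_nonneg _), ENNReal.ofReal_natCast]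
      _ ≤ ENNReal.ofReal (ε i) := ENNReal.ofReal_le_ofReal (hF i)
  -- A negative radius gives empty balls, of diameter `0`, where the gauge vanishes.
  · refine le_trans (le_of_eq (Finset.sum_eq_zero fun c _ => ?_)) bot_le
    rw [Metric.closedBall_eq_empty.2 (not_le.1 hρi)]
    simp [logGauge, Real.zero_rpow (show (1 + 3 * α) / 2 ≠ 0 by positivity)]

/-! ### All directions from slopes between 0 and 1 -/

/-- The symmetries of the square with vertices `(±1, ±1)`. -/
noncomputable def squareSymmetry (σ τ : ℤˣ) (w : Bool) : Plane →ₗᵢ[ℝ] Plane where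
  toFun v := !₂[((σ : ℤ) : ℝ) * v (if w then 1 else 0), ((τ : ℤ) : ℝ) * v (if w then 0 else 1)]
  map_add' u v := by ext i; fin_cases i <;> simp [mul_add]
  map_smul' c v := by ext i; fin_cases i <;> simp [mul_left_comm]
  norm_map' v := by
    have hsq : ∀ σ : ℤˣ, ((σ : ℤ) : ℝ) ^ 2 = 1 := fun σ => by
      have h : (σ : ℤ) ^ 2 = 1 := by
        rw [← Units.val_pow_eq_pow_val, Int.units_sq, Units.val_one]
      exact_mod_cast h
    simp only [LinearMap.coe_mk, AddHom.coe_mk, EuclideanSpace.norm_eq, Fin.sum_univ_two,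
      Real.norm_eq_abs, sq_abs]
    cases w <;> simp [mul_pow, hsq, add_comm]

lemma exists_squareSymmetry (e : Plane) : ∃ (σ τ : ℤˣ) (w : Bool) (e₀ : Plane),
    squareSymmetry σ τ w e₀ = e ∧ 0 ≤ e₀ 1 ∧ e₀ 1 ≤ e₀ 0 := by
  have hsign : ∀ x : ℝ, ∃ σ : ℤˣ, ((σ : ℤ) : ℝ) * |x| = x := by
    intro x
    rcases le_total 0 x with hx | hx
    · exact ⟨1, by simp [abs_of_nonneg hx]⟩
    · exact ⟨-1, by simp [abs_of_nonpos hx]⟩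
  obtain ⟨σ, hσ⟩ := hsign (e 0)
  obtain ⟨τ, hτ⟩ := hsign (e 1)
  rcases le_total |e 1| |e 0| with hle | hle
  · refine ⟨σ, τ, false, !₂[|e 0|, |e 1|], ?_, by simp, by simpa using hle⟩
    ext i
    fin_cases i <;> simp [squareSymmetry, hσ, hτ]
  · refine ⟨σ, τ, true, !₂[|e 1|, |e 0|], ?_, by simp, by simpa using hle⟩
    ext i
    fin_cases i <;> simp [squareSymmetry, hσ, hτ]

/-- The union of the graphs over `K` of the lines of slope `t ∈ [0, 1]` and intercept `b t`. -/
def lineUnion (K : Set ℝ) (b : ℝ → ℝ) : Set Plane :=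
  {v | v 0 ∈ K ∧ ∃ t, 0 ≤ t ∧ t ≤ 1 ∧ v 1 = b t + t * v 0}

/-- The unit segment starts at abscissa `0` and, since `e 1 ≤ e 0` forces `e 0 ≥ 1 / 2`, it reaches
over all of `K`. The first coordinate is a 1-Lipschitz map from the intersection onto a set
containing `K`. -/
lemma exists_segment_lineUnion {K : Set ℝ} {b : ℝ → ℝ} (hK : ∀ x ∈ K, 0 ≤ x ∧ x ≤ 1 / 2)
    {e : Plane} (he : ‖e‖ = 1) (he1 : 0 ≤ e 1) (he0 : e 1 ≤ e 0) :
    ∃ a, dimH K ≤ dimH (lineUnion K b ∩ segment ℝ a (a + e)) := by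
  have hsq : e 0 ^ 2 + e 1 ^ 2 = 1 := by
    have h1 := EuclideanSpace.norm_sq_eq e
    rw [he, Fin.sum_univ_two, Real.norm_eq_abs, Real.norm_eq_abs, sq_abs, sq_abs] at h1
    linarith
  have hc : 1 / 2 ≤ e 0 := by nlinarith
  have hc0 : 0 < e 0 := by linarith
  set t := e 1 / e 0 with ht
  have hte : t * e 0 = e 1 := by rw [ht]; field_simp
  refine ⟨!₂[0, b t], ?_⟩
  have hlip : LipschitzWith 1 fun v : Plane => v 0 := by
    refine LipschitzWith.of_dist_le_mul fun u v => ?_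
    rw [NNReal.coe_one, one_mul, dist_eq_norm u v, Real.dist_eq, ← Real.norm_eq_abs]
    exact PiLp.norm_apply_le (u - v) 0
  refine le_trans (dimH_mono ?_) (hlip.dimH_image_le _)
  intro x hx
  obtain ⟨hx0, hx1⟩ := hK x hx
  refine ⟨!₂[x, b t + t * x], ⟨⟨by simpa using hx, t, by positivity, ?_, by simp⟩, ?_⟩, by simp⟩
  · exact (div_le_one hc0).2 he0
  · rw [segment_eq_image']
    refine ⟨x / e 0, ⟨by positivity, (div_le_one hc0).2 (by linarith)⟩, ?_⟩
    ext i
    fin_cases i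
    · simp [hc0.ne']
    · simp [ht]
      ring

lemma isFurstenbergSet_iUnion {α : ℝ} {K : Set ℝ} {b : ℝ → ℝ} (hK : ∀ x ∈ K, 0 ≤ x ∧ x ≤ 1 / 2)
    (hdim : ENNReal.ofReal α ≤ dimH K) :
    IsFurstenbergSet α (⋃ z : ℤˣ × ℤˣ × Bool, squareSymmetry z.1 z.2.1 z.2.2 '' lineUnion K b) := by
  intro e he
  obtain ⟨σ, τ, w, e₀, rfl, h1, h0⟩ := exists_squareSymmetry e
  rw [LinearIsometry.norm_map] at he
  obtain ⟨a, ha⟩ := exists_segment_lineUnion (b := b) hK he h1 h0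
  refine ⟨squareSymmetry σ τ w a, (hdim.trans ha).trans ?_⟩
  rw [← (squareSymmetry σ τ w).isometry.dimH_image]
  refine dimH_mono ?_
  rintro _ ⟨v, ⟨hv, hs⟩, rfl⟩
  refine ⟨Set.mem_iUnion.2 ⟨(σ, τ, w), v, hv, rfl⟩, ?_⟩
  rw [← map_add]
  exact (image_segment ℝ (squareSymmetry σ τ w).toLinearMap.toAffineMap a (a + e₀)).subset ⟨v, hs, rfl⟩

end Furstenberg

/-! ### Conclusion -/

theorem mainTheorem5 (α : ℝ) (hα0 : 0 < α) (hα1 : α ≤ 1) (θ : ℝ) (hθ : (1 + 3 * α) / 2 < θ) :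
    ∃ E : Set Furstenberg.Plane, Furstenberg.IsFurstenbergSet α E ∧
      Furstenberg.gaugeMeasure (Furstenberg.logGauge α θ) E = 0 := by
  classical
  obtain ⟨N, m, Q, M, h⟩ := Furstenberg.exists_scales hα0 hα1
  obtain ⟨K, hK, hdim⟩ := h.exists_abscissas hα1
  choose b hb using h.exists_intercept
  refine ⟨_, Furstenberg.isFurstenbergSet_iUnion (b := b) (fun x hx => ⟨(hK x hx).1, (hK x hx).2.1⟩)
    hdim, ?_⟩
  rw [MeasureTheory.measure_iUnion_null_iff]
  rintro ⟨σ, τ, w⟩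
  refine Furstenberg.gaugeMeasure_logGauge_eq_zero hα0 (by linarith)
    (F := fun i => (Furstenberg.Scales.centers N m Q i).image (Furstenberg.squareSymmetry σ τ w))
    (ρ := fun i => 5 / (N (i + 1) : ℝ)) (ε := fun i => 1 / ((i : ℝ) + 1)) ?_
    tendsto_one_div_add_atTop_nhds_zero_nat ?_ ?_
  · exact (h.tendsto_N.comp (Filter.tendsto_add_atTop_nat 1)).const_div_atTop 5
  · rintro i _ ⟨v, ⟨hvK, t, ht0, ht1, hv⟩, rfl⟩
    obtain ⟨-, hx1, hx⟩ := hK _ hvK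
    obtain ⟨x₀, hx₀, hle, hge⟩ := hx i
    obtain ⟨A, p, q, l, hA, hp, hq, hl, hmem⟩ :=
      h.exists_center ht0 ht1 (hb t) i hx1 hv hx₀ hle hge
    refine ⟨_, Finset.mem_image_of_mem _ (Finset.mem_image.2 ⟨(A, p, q, l), ?_, rfl⟩), ?_⟩
    · simp only [Finset.mem_product, Finset.mem_range]
      omega
    · rw [Metric.mem_closedBall, (Furstenberg.squareSymmetry σ τ w).isometry.dist_eq]
      exact hmem
  · intro i
    have h1 : (((Furstenberg.Scales.centers N m Q i).image
        (Furstenberg.squareSymmetry σ τ w)).card : ℝ) ≤ 24 * N i * m i * (Q i : ℝ) ^ 3 := by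
      exact_mod_cast Finset.card_image_le.trans (h.card_centers_le i)
    refine le_trans ?_ (h.cover i)
    rw [show (2 : ℝ) * (5 / N (i + 1)) = 10 / N (i + 1) by ring]
    gcongr
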